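/- All rings are associative with unity. For rings $R\subseteq A$ and elements $x_1,\dots,x_n\in A$, we say that $A=\sigma(R)\langle x_1,\dots,x_n\rangle$ is a skew PBW extension of $R$ if: (a) $A$ is a free left $R$-module with basis the monomials $x^\alpha=x_1^{\alpha_1}\cdots x_n^{\alpha_n}$, $\alpha\in\mathbb N^n$; (b) for every $i$ and every $0\ne r\in R$ there is $0\neq c_{i,r}\in R$ with $x_ir-c_{i,r}x_i\in R$; (c) for all $i,j$ there is $0\ne c_{i,j}\in R$ with $x_jx_i-c_{i,j}x_ix_j\in R+Rx_1+\cdots+Rx_n$. Then $x_ir=\sigma_i(r)x_i+\delta_i(r)$ $(r\in R)$ for unique injective ring endomorphisms $\sigma_i$ and $\sigma_i$-derivations $\delta_i$ of $R$. Write $\Sigma=\{\sigma_1,\dots,\sigma_n\}$, $\Delta=\{\delta_1,\dots,\delta_n\}$, $\sigma^\alpha=\sigma_1^{\alpha_1}\circ\cdots\circ\sigma_n^{\alpha_n}$, $\delta^\beta=\delta_1^{\beta_1}\circ\cdots\circ\delta_n^{\beta_n}$. The ring $R$ is $\Sigma$-rigid if $r\sigma^\alpha(r)=0$ implies $r=0$,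 for all $r\in R$, $\alpha\in\mathbb N^n$. Let $\overline{\sigma_k},\overline{\delta_k}:A\to A$ be the coefficientwise extensions $\overline{\sigma_k}(\sum_\alpha a_\alpha x^\alpha)=\sum_\alpha\sigma_k(a_\alpha)x^\alpha$, $\overline{\delta_k}(\sum_\alpha a_\alpha x^\alpha)=\sum_\alpha\delta_k(a_\alpha)x^\alpha$, and let $\overline\Sigma=\{\overline{\sigma_1},\dots,\overline{\sigma_n}\}$, $\overline\Delta=\{\overline{\delta_1},\dots,\overline{\delta_n}\}$. A ring $B$ is weak symmetric if $abc$ nilpotent implies $acb$ nilpotent, for all $a,b,c\in B$; it is reversible if $ab=0$ implies $ba=0$. $A$ is $(\overline\Sigma,\overline\Delta)$-compatible if for all $f,g\in A$: $f\,\overline{\sigma}^{\alpha}(g)=0$ if and only if $fg=0$, for every $\alpha\in\mathbb N^n$; and $fg=0$ implies $f\,\overline{\delta}^{\beta}(g)=0$ for every $\beta\in\mathbb N^n$. **Theorem.** Let $A=\sigma(R)\langle x_1,\dots,x_n\rangle$ be a skew PBW extension of a $\Sigma$-rigid ring $R$ in which the elements $c_{i,j}$ are central in $R$. Let $A'=\sigma(A)\langle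 x_1',\dots,x_n'\rangle$ be a skew PBW extension of $A$ whose endomorphisms and derivations are $\overline\Sigma$ and $\overline\Delta$, that is, $x_k'f=\overline{\sigma_k}(f)x_k'+\overline{\delta_k}(f)$ for all $f\in A$ and $1\le k\le n$. Then $A$ is reversible and $(\overline\Sigma,\overline\Delta)$-compatible, and $A$ is weak symmetric if and only if $A'$ is weak symmetric. -/

import Mathlib

namespace SkewPBW

section Rings

/-- `B` is weak symmetric: `abc ∈ nil(B)` implies `acb ∈ nil(B)`. -/
def WeakSymmetric (B : Type*) [Ring B] : Prop :=
  ∀ a b c : B, IsNilpotent (a * b * c) → IsNilpotent (a * c * b)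

/-- `B` is reversible: `ab = 0` implies `ba = 0`. -/
def Reversible (B : Type*) [Ring B] : Prop :=
  ∀ a b : B, a * b = 0 → b * a = 0

/-- For a family `φ = (φ₁, …, φₙ)` of self-maps and `α ∈ ℕⁿ`, the composite
`φ^α = φ₁^{α₁} ∘ ⋯ ∘ φₙ^{αₙ}`. -/
def iter {B : Type*} {n : ℕ} (φ : Fin n → B → B) (α : Fin n → ℕ) : B → B :=
  (List.ofFn fun i => (φ i)^[α i]).foldr (fun g h => g ∘ h) id

/-- A family of endomorphisms is rigid if `r σ^α(r) = 0` implies `r = 0`, for all `r` and `α`. -/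
def Rigid {B : Type*} [Ring B] {n : ℕ} (σ : Fin n → B → B) : Prop :=
  ∀ (r : B) (α : Fin n → ℕ), r * iter σ α r = 0 → r = 0

/-- `Σ`-compatibility: `a σ^α(b) = 0` if and only if `ab = 0`. -/
def SigmaCompatible {B : Type*} [Ring B] {n : ℕ} (σ : Fin n → B → B) : Prop :=
  ∀ (a b : B) (α : Fin n → ℕ), a * iter σ α b = 0 ↔ a * b = 0

/-- `Δ`-compatibility: `ab = 0` implies `a δ^β(b) = 0`. -/
def DeltaCompatible {B : Type*} [Ring B] {n : ℕ} (δ : Fin n → B → B) : Prop :=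
  ∀ a b : B, a * b = 0 → ∀ β : Fin n → ℕ, a * iter δ β b = 0

/-- `(Σ, Δ)`-compatibility. -/
def Compatible {B : Type*} [Ring B] {n : ℕ} (σ δ : Fin n → B → B) : Prop :=
  SigmaCompatible σ ∧ DeltaCompatible δ

end Rings

/-- The standard monomial `x^α = x₁^{α₁} ⋯ xₙ^{αₙ}`, factors in this order. -/
def mon {A : Type*} [Ring A] {n : ℕ} (x : Fin n → A) (α : Fin n → ℕ) : A :=
  (List.ofFn fun i => x i ^ α i).prod

/-- `c` is a coefficient `c_{i,j}`: `c ≠ 0` and `x_j x_i - c x_i x_j ∈ R + R x₁ + ⋯ + R xₙ`. -/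
def IsCommCoeff {R A : Type*} [Ring R] [Ring A] [Module R A] {n : ℕ}
    (x : Fin n → A) (i j : Fin n) (c : R) : Prop :=
  c ≠ 0 ∧ ∃ (r₀ : R) (r : Fin n → R),
    x j * x i - c • (x i * x j) = r₀ • (1 : A) + ∑ k, r k • x k

/-- `A` is a skew PBW extension `σ(R)⟨x₁, …, xₙ⟩` of `R`.

The ring homomorphism `R → A` is encoded by `[Module R A] [IsScalarTower R A A]`: it sends `r` to
`r • 1`, and `r • a = (r • 1) * a` for all `a`. It is injective (so `R ⊆ A`) because the monomial
`1` belongs to an `R`-basis. -/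
structure IsSkewPBW (R : Type*) {A : Type*} [Ring R] [Ring A] [Module R A] [IsScalarTower R A A]
    {n : ℕ} (x : Fin n → A) : Prop where
  linearIndependent : LinearIndependent R (mon x)
  span_eq_top : Submodule.span R (Set.range (mon x)) = ⊤
  exists_coeff : ∀ (i : Fin n) (r : R), r ≠ 0 →
    ∃ c : R, c ≠ 0 ∧ ∃ d : R, x i * (r • (1 : A)) - c • x i = d • (1 : A)
  exists_commCoeff : ∀ i j : Fin n, ∃ c : R, IsCommCoeff x i j c

section Lemmas

variable {R A : Type*} [Ring R] [Ring A] [Module R A] [IsScalarTower R A A]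
  {n : ℕ} {x : Fin n → A}

theorem mon_zero (x : Fin n → A) : mon x 0 = 1 := by
  simp [mon]

theorem mon_single (x : Fin n → A) (i : Fin n) : mon x (Pi.single i 1) = x i := by
  induction n with
  | zero => exact i.elim0
  | succ n ih =>
    unfold mon at ih ⊢
    rw [List.ofFn_succ, List.prod_cons]
    induction i using Fin.cases with
    | zero => simp
    | succ j =>
      have := ih (fun k => x k.succ) j
      simp only [Pi.single_apply, Fin.succ_inj] at this ⊢
      rw [this]
      simp [(Fin.succ_ne_zero j).symm]

namespace IsSkewPBW

/-- The `R`-basis `Mon(A)` of `A`. -/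
noncomputable def basis (h : IsSkewPBW R x) : Module.Basis (Fin n → ℕ) R A :=
  Module.Basis.mk h.linearIndependent h.span_eq_top.ge

theorem basis_apply (h : IsSkewPBW R x) (α : Fin n → ℕ) : h.basis α = mon x α := by
  simp [basis]

theorem exists_rel (h : IsSkewPBW R x) (i : Fin n) (r : R) :
    ∃ c d : R, x i * (r • (1 : A)) = c • x i + d • (1 : A) := by
  by_cases hr : r = 0
  · exact ⟨0, 0, by simp [hr]⟩
  · obtain ⟨c, -, d, hd⟩ := h.exists_coeff i r hr
    exact ⟨c, d, by rw [← hd]; abel⟩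

theorem repr_rel (h : IsSkewPBW R x) (i : Fin n) (c d : R) :
    h.basis.repr (c • x i + d • (1 : A)) (Pi.single i 1) = c ∧
    h.basis.repr (c • x i + d • (1 : A)) 0 = d := by
  have h1 : (1 : A) = h.basis 0 := by rw [basis_apply, mon_zero]
  have h2 : x i = h.basis (Pi.single i 1) := by rw [basis_apply, mon_single]
  have h3 : (Pi.single i 1 : Fin n → ℕ) ≠ 0 := by simp
  rw [h1, h2]
  constructor <;> simp [h3, h3.symm]

/-- `σᵢ(r)`: the coefficient of `xᵢ` in `xᵢ r`. -/
noncomputable def sigmaFun (h : IsSkewPBW R x) (i : Fin n) (r : R) : R :=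
  h.basis.repr (x i * (r • (1 : A))) (Pi.single i 1)

/-- `δᵢ(r)`: the coefficient of `1` in `xᵢ r`. -/
noncomputable def deltaFun (h : IsSkewPBW R x) (i : Fin n) (r : R) : R :=
  h.basis.repr (x i * (r • (1 : A))) 0

/-- The defining relation `xᵢ r = σᵢ(r) xᵢ + δᵢ(r)`. -/
theorem rel (h : IsSkewPBW R x) (i : Fin n) (r : R) :
    x i * (r • (1 : A)) = h.sigmaFun i r • x i + h.deltaFun i r • (1 : A) := by
  obtain ⟨c, d, hcd⟩ := h.exists_rel i r
  obtain ⟨hc, hd⟩ := h.repr_rel i c d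
  rw [sigmaFun, deltaFun, hcd, hc, hd]

theorem eq_of_rel (h : IsSkewPBW R x) {i : Fin n} {r c d : R}
    (e : x i * (r • (1 : A)) = c • x i + d • (1 : A)) :
    h.sigmaFun i r = c ∧ h.deltaFun i r = d := by
  obtain ⟨hc, hd⟩ := h.repr_rel i c d
  rw [sigmaFun, deltaFun, e]
  exact ⟨hc, hd⟩

theorem rel_mul (h : IsSkewPBW R x) (i : Fin n) (r s : R) :
    x i * ((r * s) • (1 : A)) = (h.sigmaFun i r * h.sigmaFun i s) • x i +
      (h.sigmaFun i r * h.deltaFun i s + h.deltaFun i r * s) • (1 : A) := by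
  have e : ((r * s) • (1 : A)) = (r • (1 : A)) * (s • (1 : A)) := by
    rw [smul_mul_assoc, one_mul, smul_smul]
  rw [e, ← mul_assoc, h.rel i r, add_mul, smul_mul_assoc, h.rel i s, smul_mul_assoc, one_mul,
    smul_add, smul_smul, smul_smul, smul_smul, add_smul, add_assoc]

theorem rel_add (h : IsSkewPBW R x) (i : Fin n) (r s : R) :
    x i * ((r + s) • (1 : A)) = (h.sigmaFun i r + h.sigmaFun i s) • x i +
      (h.deltaFun i r + h.deltaFun i s) • (1 : A) := by
  rw [add_smul, mul_add, h.rel i r, h.rel i s, add_smul, add_smul]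
  abel

/-- The endomorphism `σᵢ` of `R`. -/
noncomputable def sigma (h : IsSkewPBW R x) (i : Fin n) : R →+* R where
  toFun := h.sigmaFun i
  map_one' := (h.eq_of_rel (d := 0) (by simp)).1
  map_mul' r s := (h.eq_of_rel (h.rel_mul i r s)).1
  map_zero' := (h.eq_of_rel (d := 0) (by simp)).1
  map_add' r s := (h.eq_of_rel (h.rel_add i r s)).1

/-- The `σᵢ`-derivation `δᵢ` of `R`, as an additive map. -/
noncomputable def delta (h : IsSkewPBW R x) (i : Fin n) : R →+ R where
  toFun := h.deltaFun i
  map_zero' := (h.eq_of_rel (c := 0) (by simp)).2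
  map_add' r s := (h.eq_of_rel (h.rel_add i r s)).2

theorem delta_mul (h : IsSkewPBW R x) (i : Fin n) (r s : R) :
    h.delta i (r * s) = h.sigma i r * h.delta i s + h.delta i r * s :=
  (h.eq_of_rel (h.rel_mul i r s)).2

/-- The coefficientwise extension of an additive map `φ` of `R` to `A`:
`a₀ + a₁X₁ + ⋯ + aₘXₘ ↦ φ(a₀) + φ(a₁)X₁ + ⋯ + φ(aₘ)Xₘ`. -/
noncomputable def coeffMap (h : IsSkewPBW R x) (φ : R →+ R) (f : A) : A :=
  (h.basis.repr f).sum fun α a => φ a • mon x α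

/-- The extension of `σₖ` to `A`. -/
noncomputable def sigmaBar (h : IsSkewPBW R x) (k : Fin n) : A → A :=
  h.coeffMap (h.sigma k : R →+ R)

/-- The extension of `δₖ` to `A`. -/
noncomputable def deltaBar (h : IsSkewPBW R x) (k : Fin n) : A → A :=
  h.coeffMap (h.delta k)

/-- `A'` is a skew PBW extension `σ(A)⟨x'₁, …, x'ₙ⟩` of `A` whose endomorphisms and derivations
are the extensions to `A` of the `σₖ` and `δₖ`, that is,
`x'ₖ f = sigmaBar k f · x'ₖ + deltaBar k f` for every `f ∈ A`. -/
structure IsInduced (h : IsSkewPBW R x) {A' : Type*} [Ring A'] [Module A A']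
    [IsScalarTower A A' A'] (x' : Fin n → A') : Prop where
  isSkewPBW : IsSkewPBW A x'
  rel : ∀ (k : Fin n) (f : A),
    x' k * (f • (1 : A')) = h.sigmaBar k f • x' k + h.deltaBar k f • (1 : A')

end IsSkewPBW

end Lemmas

end SkewPBW

/-! Rigidity forces `R` to be reduced, and the same property climbs to `A` and then to `A'`. In a
reduced ring nilpotent means zero, `ab = 0` gives `ba = 0`, and factors may be inserted into a zero
product. So reversibility and weak symmetry are automatic, and the equivalence holds because both
sides are true.

The core is the Armendariz property `mul_eq_zero_iff_coeff`: `fg = 0` exactly when every coefficient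
of `f` kills every coefficient of `g`. It rests on `exists_mon_mul_smul_mon`: modulo lower total
degree, `x^α r x^β` is `s(r) x^(α+β)`, where `s` is built from the `σᵢ` and right multiplications by
units. Such an `s` preserves and reflects annihilation.

Compatibility is then checked coefficient by coefficient. Compatibility and reducedness of `A` make
the extended family rigid, so the reducedness theorem applies again with `A` as coefficient ring. -/

namespace SkewPBW

/-! ### Reduced rings -/

section Reduced

variable {B : Type*} [Ring B]

theorem mul_eq_zero_swap [IsReduced B] {a b : B} (h : a * b = 0) : b * a = 0 := by
  have : (b * a) ^ 2 = 0 := by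
    rw [sq, mul_assoc, ← mul_assoc a, h, zero_mul, mul_zero]
  exact eq_zero_of_pow_eq_zero this

theorem mul_mul_eq_zero_of_mul_eq_zero [IsReduced B] {a b : B} (h : a * b = 0) (r : B) :
    a * r * b = 0 := by
  apply mul_eq_zero_swap
  rw [← mul_assoc, mul_eq_zero_swap h, zero_mul]

theorem isReduced_of_mul_self (h : ∀ a : B, a * a = 0 → a = 0) : IsReduced B :=
  (isReduced_iff_pow_one_lt 2 one_lt_two).2 fun a ha => h a (by rwa [← sq])

/-- Since `(1 - ba)b = 0`, also `b(1 - ba) = 0`; multiplying by `a` on the left gives `1 - ba = 0`.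
-/
theorem mul_eq_one_swap [IsReduced B] {a b : B} (h : a * b = 1) : b * a = 1 := by
  have h1 : (1 - b * a) * b = 0 := by rw [sub_mul, mul_assoc, h, one_mul, mul_one, sub_self]
  have h2 := mul_eq_zero_swap h1
  have h3 : a * (b * (1 - b * a)) = 1 - b * a := by rw [← mul_assoc, h, one_mul]
  rw [h2, mul_zero] at h3
  exact (sub_eq_zero.1 h3.symm).symm

theorem reversible_of_isReduced [IsReduced B] : Reversible B := fun _ _ => mul_eq_zero_swap

theorem weakSymmetric_of_isReduced [IsReduced B] : WeakSymmetric B := by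
  intro a b c h
  have h0 : a * (b * c) = 0 := by rw [← mul_assoc]; exact h.eq_zero
  have h1 : a * c * (b * c) = 0 := mul_mul_eq_zero_of_mul_eq_zero h0 c
  have h2 : a * c * b * (a * c * b) = 0 := by
    have h3 : (a * c * b) * c = 0 := by rw [mul_assoc (a * c), h1]
    have h4 := mul_mul_eq_zero_of_mul_eq_zero h3 a
    have h5 : a * c * b * (a * c) = 0 := by rw [← mul_assoc]; exact h4
    rw [← mul_assoc, h5, zero_mul]
  have : a * c * b = 0 := eq_zero_of_pow_eq_zero (n := 2) (by rw [sq, h2])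
  rw [this]
  exact IsNilpotent.zero

/-- `s` preserves and reflects right annihilation. -/
def AnnIff (s : B → B) : Prop := ∀ a b : B, a * s b = 0 ↔ a * b = 0

theorem AnnIff.comp {s t : B → B} (hs : AnnIff s) (ht : AnnIff t) : AnnIff (s ∘ t) :=
  fun a b => (hs a (t b)).trans (ht a b)

theorem AnnIff.mul_unit {s : B → B} (hs : AnnIff s) {u : B} (hu : IsUnit u) :
    AnnIff fun r => s r * u := fun a b => by
  rw [← mul_assoc, hu.mul_left_eq_zero]
  exact hs a b

end Reduced

/-! ### Composites of a family of maps -/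

section Iter

variable {B : Type*} {n : ℕ}

theorem iter_succ (φ : Fin (n + 1) → B → B) (α : Fin (n + 1) → ℕ) :
    iter φ α = (φ 0)^[α 0] ∘ iter (fun i => φ i.succ) fun i => α i.succ := by
  simp [iter, List.ofFn_succ]

theorem iter_zero (φ : Fin n → B → B) : iter φ 0 = id := by
  induction n with
  | zero => rfl
  | succ n ih =>
    rw [iter_succ]
    exact ih fun i => φ i.succ

theorem iter_single (φ : Fin n → B → B) (i : Fin n) : iter φ (Pi.single i 1) = φ i := by
  induction n with
  | zero => exact i.elim0
  | succ n ih =>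
    rw [iter_succ]
    induction i using Fin.cases with
    | zero =>
      have : (fun i : Fin n => (Pi.single 0 1 : Fin (n + 1) → ℕ) i.succ) = 0 := by
        ext i; simp
      rw [this, iter_zero]
      simp
    | succ j =>
      have : (fun i : Fin n => (Pi.single j.succ 1 : Fin (n + 1) → ℕ) i.succ) =
          Pi.single j 1 := by
        ext i; simp [Pi.single_apply]
      rw [this, ih fun i => φ i.succ]
      simp [(Fin.succ_ne_zero j).symm]

theorem iter_induction {P : (B → B) → Prop} (hid : P id)
    (hcomp : ∀ s t, P s → P t → P (s ∘ t)) {φ : Fin n → B → B} (h : ∀ i, P (φ i))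
    (α : Fin n → ℕ) : P (iter φ α) := by
  induction n with
  | zero => exact hid
  | succ n ih =>
    rw [iter_succ]
    refine hcomp _ _ ?_ (ih (fun i => h i.succ) _)
    induction α 0 with
    | zero => exact hid
    | succ m ihm => exact hcomp _ _ ihm (h 0)

theorem iter_semiconj {C : Type*} {g : B → C} {φ : Fin n → B → B} {ψ : Fin n → C → C}
    (h : ∀ i, Function.Semiconj g (φ i) (ψ i)) (α : Fin n → ℕ) :
    Function.Semiconj g (iter φ α) (iter ψ α) := by
  induction n with
  | zero => exact Function.Semiconj.id_right
  | succ n ih =>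
    rw [iter_succ, iter_succ]
    exact ((h 0).iterate_right _).comp_right (ih (fun i => h i.succ) _)

end Iter

/-! ### Standard monomials and their exponents -/

section Monomials

variable {A : Type*} [Ring A] {n : ℕ}

theorem mon_succ (x : Fin (n + 1) → A) (α : Fin (n + 1) → ℕ) :
    mon x α = x 0 ^ α 0 * mon (fun i => x i.succ) fun i => α i.succ := by
  simp [mon, List.ofFn_succ]

/-- With no variable before `x j` in the monomial, the product is already in standard order, so no
commutation relation is needed. -/
theorem mon_single_add (x : Fin n → A) {j : Fin n} {α : Fin n → ℕ} (h : ∀ k < j, α k = 0) :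
    mon x (Pi.single j 1 + α) = x j * mon x α := by
  induction n with
  | zero => exact j.elim0
  | succ n ih =>
    rw [mon_succ, mon_succ x α]
    induction j using Fin.cases with
    | zero =>
      have : (fun i : Fin n => (Pi.single 0 1 + α : Fin (n + 1) → ℕ) i.succ) =
          fun i => α i.succ := by
        ext i; simp
      rw [this, ← mul_assoc]
      simp [pow_add]
    | succ j =>
      have : (fun i : Fin n => (Pi.single j.succ 1 + α : Fin (n + 1) → ℕ) i.succ) =
          Pi.single j 1 + fun i => α i.succ := by
        ext i; simp [Pi.single_apply]
      rw [this, ih (fun i => x i.succ) fun k hk => h k.succ (Fin.succ_lt_succ_iff.2 hk)]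
      simp [h 0 (Fin.succ_pos j), (Fin.succ_ne_zero j).symm]

theorem exists_eq_single_add {α : Fin n → ℕ} (hα : α ≠ 0) :
    ∃ (j : Fin n) (β : Fin n → ℕ), α = Pi.single j 1 + β ∧ ∀ k < j, β k = 0 := by
  obtain ⟨i, hi⟩ := Function.ne_iff.1 hα
  obtain ⟨j, hj, hmin⟩ := (wellFounded_lt (α := Fin n)).has_min {k | α k ≠ 0} ⟨i, hi⟩
  refine ⟨j, α - Pi.single j 1, ?_, fun k hk => ?_⟩
  · ext k
    by_cases hk : k = j
    · subst hk
      have : α k ≠ 0 := hj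
      simp; omega
    · simp [hk]
  · have : α k = 0 := by
      by_contra h0
      exact hmin k h0 hk
    simp [this]

theorem sum_single_add (j : Fin n) (α : Fin n → ℕ) :
    ∑ i, (Pi.single j 1 + α : Fin n → ℕ) i = (∑ i, α i) + 1 := by
  simp [Finset.sum_add_distrib, add_comm]

theorem exponent_induction {P : (Fin n → ℕ) → Prop} (zero : P 0)
    (single_add : ∀ (j : Fin n) (α : Fin n → ℕ), (∀ k < j, α k = 0) → P α →
      P (Pi.single j 1 + α)) (α : Fin n → ℕ) : P α := by
  induction hd : ∑ i, α i generalizing α with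
  | zero =>
    have : α = 0 := by ext i; simpa using (Finset.sum_eq_zero_iff.1 hd) i
    exact this ▸ zero
  | succ d ih =>
    have hα : α ≠ 0 := by rintro rfl; simp at hd
    obtain ⟨j, β, rfl, hβ⟩ := exists_eq_single_add hα
    rw [sum_single_add] at hd
    exact single_add j β hβ (ih β (by omega))

end Monomials

/-! ### Filtration by total degree and coefficients -/

namespace IsSkewPBW

variable {R A : Type*} [Ring R] [Ring A] [Module R A] {n : ℕ} {x : Fin n → A}

/-- The `R`-submodule of elements of total degree less than `d`. -/
def degreeLT (R : Type*) {A : Type*} [Ring R] [Ring A] [Module R A] {n : ℕ} (x : Fin n → A)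
    (d : ℕ) : Submodule R A :=
  Submodule.span R (mon x '' {γ | ∑ i, γ i < d})

theorem mon_mem_degreeLT {γ : Fin n → ℕ} {d : ℕ} (hd : ∑ i, γ i < d) :
    mon x γ ∈ degreeLT R x d :=
  Submodule.subset_span ⟨γ, hd, rfl⟩

theorem degreeLT_mono {d e : ℕ} (hde : d ≤ e) : degreeLT R x d ≤ degreeLT R x e :=
  Submodule.span_mono (Set.image_mono fun _ hγ => lt_of_lt_of_le hγ hde)

theorem linear_mem_degreeLT (r₀ : R) (r : Fin n → R) :
    r₀ • (1 : A) + ∑ k, r k • x k ∈ degreeLT R x 2 := by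
  refine add_mem (Submodule.smul_mem _ _ ?_)
    (Submodule.sum_mem _ fun k _ => Submodule.smul_mem _ _ ?_)
  · rw [← mon_zero x]
    exact mon_mem_degreeLT (by simp)
  · rw [← mon_single x k]
    exact mon_mem_degreeLT (by simp)

variable [IsScalarTower R A A]

theorem rel_smul (h : IsSkewPBW R x) (i : Fin n) (r : R) (f : A) :
    x i * (r • f) = h.sigma i r • (x i * f) + h.delta i r • f := by
  have := congrArg (· * f) (h.rel i r)
  simp only [mul_assoc, add_mul, smul_mul_assoc, one_mul] at this
  exact this

section Coefficients

theorem repr_coeffMap (h : IsSkewPBW R x) (φ : R →+ R) (f : A) (γ : Fin n → ℕ) :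
    h.basis.repr (h.coeffMap φ f) γ = φ (h.basis.repr f γ) := by
  have : h.coeffMap φ f =
      h.basis.repr.symm ((h.basis.repr f).mapRange φ (map_zero φ)) := by
    rw [coeffMap, Module.Basis.repr_symm_apply, Finsupp.linearCombination_apply,
      Finsupp.sum_mapRange_index (by simp)]
    simp [basis_apply]
  rw [this]
  simp

theorem eq_sum (h : IsSkewPBW R x) (f : A) :
    f = ∑ γ ∈ (h.basis.repr f).support, h.basis.repr f γ • mon x γ := by
  conv_lhs => rw [← h.basis.linearCombination_repr f]
  rw [Finsupp.linearCombination_apply, Finsupp.sum]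
  simp [basis_apply]

theorem ext_repr (h : IsSkewPBW R x) {f g : A}
    (e : ∀ γ, h.basis.repr f γ = h.basis.repr g γ) : f = g :=
  h.basis.repr.injective (Finsupp.ext e)

theorem repr_mon (h : IsSkewPBW R x) (α γ : Fin n → ℕ) :
    h.basis.repr (mon x α) γ = if α = γ then 1 else 0 := by
  rw [← h.basis_apply, h.basis.repr_self, Finsupp.single_apply]

end Coefficients

/-! ### Leading terms of products -/

section Degree

theorem repr_eq_zero_of_mem_degreeLT (h : IsSkewPBW R x) {d : ℕ} {f : A}
    (hf : f ∈ degreeLT R x d) {γ : Fin n → ℕ} (hγ : d ≤ ∑ i, γ i) :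
    h.basis.repr f γ = 0 := by
  induction hf using Submodule.span_induction with
  | mem f hf =>
    obtain ⟨β, hβ, rfl⟩ := hf
    rw [repr_mon, if_neg]
    rintro rfl
    exact absurd hβ (not_lt.2 hγ)
  | zero => simp
  | add f g _ _ hf hg => simp [hf, hg]
  | smul r f _ hf => simp [hf]

/-- The bound on monomials is a hypothesis so that the lemma can serve inside the induction of
`exists_mul_mon`, where it is known only in small degrees. -/
theorem mul_mem_degreeLT_of_mon (h : IsSkewPBW R x) (i : Fin n) {d : ℕ}
    (hmon : ∀ γ : Fin n → ℕ, ∑ k, γ k < d → x i * mon x γ ∈ degreeLT R x (d + 1))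
    {f : A} (hf : f ∈ degreeLT R x d) : x i * f ∈ degreeLT R x (d + 1) := by
  induction hf using Submodule.span_induction with
  | mem f hf =>
    obtain ⟨γ, hγ, rfl⟩ := hf
    exact hmon γ hγ
  | zero => simp
  | add f g _ _ hf hg => rw [mul_add]; exact add_mem hf hg
  | smul r f hf' hf =>
    rw [h.rel_smul]
    exact add_mem (Submodule.smul_mem _ _ hf)
      (Submodule.smul_mem _ _ (degreeLT_mono (Nat.le_succ d) hf'))

/-- Swapping `x i` and `x j` twice multiplies the leading term by `c' * c`, so comparing
coefficients gives `c' * c = 1`. Reducedness makes the inverse two-sided. -/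
theorem commCoeff_isUnit [IsReduced R] (h : IsSkewPBW R x) {i j : Fin n} (hij : i < j) {c : R}
    (hc : IsCommCoeff x i j c) : IsUnit c := by
  obtain ⟨-, r₀, r, e⟩ := hc
  obtain ⟨c', -, r₀', r', e'⟩ := h.exists_commCoeff j i
  have hl := linear_mem_degreeLT (x := x) r₀ r
  have hl' := linear_mem_degreeLT (x := x) r₀' r'
  rw [← e] at hl
  rw [← e'] at hl'
  have hm : x i * x j = mon x (Pi.single i 1 + Pi.single j 1) := by
    rw [mon_single_add x, mon_single]
    intro k hk
    simp [(hk.trans hij).ne]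
  have h0 := add_mem hl' (Submodule.smul_mem _ c' hl)
  have h1 : x i * x j - c' • (x j * x i) + c' • (x j * x i - c • (x i * x j)) =
      (1 - c' * c) • mon x (Pi.single i 1 + Pi.single j 1) := by
    rw [← hm, sub_smul, smul_sub, smul_smul, one_smul]
    abel
  rw [h1] at h0
  have h2 := h.repr_eq_zero_of_mem_degreeLT h0 (γ := Pi.single i 1 + Pi.single j 1)
    (by rw [sum_single_add]; simp)
  simp only [map_smul, Finsupp.smul_apply, repr_mon, if_true, smul_eq_mul, mul_one] at h2
  have h3 : c' * c = 1 := (sub_eq_zero.1 h2).symm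
  exact ⟨⟨c, c', mul_eq_one_swap h3, h3⟩, rfl⟩

theorem exists_mul_mon [IsReduced R] (h : IsSkewPBW R x) (i : Fin n) (γ : Fin n → ℕ) :
    ∃ u : R, IsUnit u ∧
      x i * mon x γ - u • mon x (Pi.single i 1 + γ) ∈ degreeLT R x (∑ k, γ k + 1) := by
  induction hd : ∑ k, γ k using Nat.strong_induction_on generalizing i γ with
  | _ d ih =>
  have hmem : ∀ (i : Fin n) (e : ℕ), e ≤ d → ∀ f ∈ degreeLT R x e,
      x i * f ∈ degreeLT R x (e + 1) := by
    intro i e he f hf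
    refine h.mul_mem_degreeLT_of_mon i (fun β hβ => ?_) hf
    obtain ⟨u, -, hu⟩ := ih _ (hβ.trans_le he) i β rfl
    have h1 : u • mon x (Pi.single i 1 + β) ∈ degreeLT R x (e + 1) :=
      Submodule.smul_mem _ _ (mon_mem_degreeLT (by rw [sum_single_add]; omega))
    have := add_mem (degreeLT_mono (by omega) hu) h1
    rwa [sub_add_cancel] at this
  by_cases hγ : ∀ k < i, γ k = 0
  · exact ⟨1, isUnit_one, by rw [mon_single_add x hγ]; simp⟩
  have hγ0 : γ ≠ 0 := by rintro rfl; simp at hγ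
  obtain ⟨j, β, rfl, hβ⟩ := exists_eq_single_add hγ0
  rw [sum_single_add] at hd
  have hji : j < i := by
    by_contra hij
    refine hγ fun k hk => ?_
    have hkj : k < j := hk.trans_le (not_lt.1 hij)
    simp [hβ k hkj, hkj.ne]
  obtain ⟨c, hc⟩ := h.exists_commCoeff j i
  have hcu := h.commCoeff_isUnit hji hc
  obtain ⟨-, r₀, r, e⟩ := hc
  obtain ⟨u, hu, hmu⟩ := ih _ (by omega) i β rfl
  -- Moving `x i` past `x j` contributes `c`; the unit `u` from the shorter monomial then crosses `x
  -- j` and becomes `σⱼ(u)`.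
  refine ⟨c * h.sigma j u, hcu.mul (hu.map _), ?_⟩
  have hmon : mon x (Pi.single i 1 + (Pi.single j 1 + β)) =
      x j * mon x (Pi.single i 1 + β) := by
    rw [add_left_comm, mon_single_add x]
    intro k hk
    simp [hβ k hk, (hk.trans hji).ne]
  have e1 : x i * x j = c • (x j * x i) + (r₀ • (1 : A) + ∑ k, r k • x k) := by
    rw [← e]; abel
  set g := x i * mon x β - u • mon x (Pi.single i 1 + β) with hg
  have e2 : x i * mon x β = u • mon x (Pi.single i 1 + β) + g := by rw [hg]; abel
  have e3 : x i * mon x (Pi.single j 1 + β) -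
      (c * h.sigma j u) • mon x (Pi.single i 1 + (Pi.single j 1 + β)) =
      c • (h.delta j u • mon x (Pi.single i 1 + β) + x j * g) +
        (r₀ • mon x β + ∑ k, r k • (x k * mon x β)) := by
    rw [hmon, mon_single_add x hβ, ← mul_assoc, e1, add_mul, smul_mul_assoc, mul_assoc, e2,
      mul_add, h.rel_smul, add_mul, smul_mul_assoc, one_mul, Finset.sum_mul]
    simp only [smul_mul_assoc, smul_add, mul_smul]
    abel
  rw [e3]
  have hβd : mon x β ∈ degreeLT R x d := mon_mem_degreeLT (by omega)
  refine add_mem (Submodule.smul_mem _ _ (add_mem (Submodule.smul_mem _ _ ?_) ?_))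
    (add_mem (Submodule.smul_mem _ _ (degreeLT_mono (Nat.le_succ d) hβd))
      (Submodule.sum_mem _ fun k _ => Submodule.smul_mem _ _ (hmem k d le_rfl _ hβd)))
  · exact mon_mem_degreeLT (by rw [sum_single_add]; omega)
  · exact hmem j d le_rfl g (by rwa [hd] at hmu)

theorem mul_mem_degreeLT [IsReduced R] (h : IsSkewPBW R x) (i : Fin n) {d : ℕ}
    {f : A} (hf : f ∈ degreeLT R x d) : x i * f ∈ degreeLT R x (d + 1) := by
  refine h.mul_mem_degreeLT_of_mon i (fun β hβ => ?_) hf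
  obtain ⟨u, -, hu⟩ := h.exists_mul_mon i β
  have h1 : u • mon x (Pi.single i 1 + β) ∈ degreeLT R x (d + 1) :=
    Submodule.smul_mem _ _ (mon_mem_degreeLT (by rw [sum_single_add]; omega))
  have := add_mem (degreeLT_mono (by omega) hu) h1
  rwa [sub_add_cancel] at this

theorem exists_mon_mul_smul_mon [IsReduced R] (h : IsSkewPBW R x)
    (hσ : ∀ i, AnnIff (h.sigma i)) (α β : Fin n → ℕ) :
    ∃ s : R → R, AnnIff s ∧ ∀ r : R, mon x α * (r • mon x β) - s r • mon x (α + β) ∈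
      degreeLT R x (∑ k, α k + ∑ k, β k) := by
  induction α using exponent_induction with
  | zero => exact ⟨id, fun _ _ => Iff.rfl, fun r => by simp [mon_zero]⟩
  | single_add j α hα ih =>
    obtain ⟨s, hs, hmem⟩ := ih
    obtain ⟨u, hu, hmu⟩ := h.exists_mul_mon j (α + β)
    refine ⟨fun r => h.sigma j (s r) * u, ((hσ j).comp hs).mul_unit hu, fun r => ?_⟩
    have hsum : ∑ k, (α + β) k = ∑ k, α k + ∑ k, β k := by simp [Finset.sum_add_distrib]
    rw [sum_single_add, mon_single_add x hα, add_right_comm, add_assoc (Pi.single j 1)]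
    have e : x j * mon x α * (r • mon x β) -
        (h.sigma j (s r) * u) • mon x (Pi.single j 1 + (α + β)) =
        x j * (mon x α * (r • mon x β) - s r • mon x (α + β)) +
        (h.sigma j (s r) • (x j * mon x (α + β) - u • mon x (Pi.single j 1 + (α + β))) +
          h.delta j (s r) • mon x (α + β)) := by
      rw [mul_sub, h.rel_smul, smul_sub, mul_smul, mul_assoc]
      abel
    rw [e]
    refine add_mem (h.mul_mem_degreeLT j (hmem r)) (add_mem (Submodule.smul_mem _ _ ?_)
      (Submodule.smul_mem _ _ (mon_mem_degreeLT ?_)))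
    · rwa [hsum] at hmu
    · rw [hsum]; omega

/-- Some product of a coefficient of `f` with a coefficient of `g` occurs, up to a map that
preserves and reflects annihilation, as a coefficient of `f * g`. -/
theorem exists_coeff_mul_eq_zero [IsReduced R] (h : IsSkewPBW R x)
    (hσ : ∀ i, AnnIff (h.sigma i)) {f g : A} (hf : f ≠ 0) (hg : g ≠ 0) (hfg : f * g = 0) :
    ∃ α β, h.basis.repr f α ≠ 0 ∧ h.basis.repr g β ≠ 0 ∧
      h.basis.repr f α * h.basis.repr g β = 0 := by
  classical
  have hsupp : ∀ f : A, f ≠ 0 → (h.basis.repr f).support.Nonempty := fun f hf => by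
    simpa [Finsupp.support_nonempty_iff] using hf
  obtain ⟨μ, hμ, hμmax⟩ :=
    Finset.exists_max_image (h.basis.repr f).support (fun γ => ∑ k, γ k) (hsupp f hf)
  obtain ⟨ν, hν, hνmax⟩ :=
    Finset.exists_max_image (h.basis.repr g).support (fun γ => ∑ k, γ k) (hsupp g hg)
  -- Total degree may leave several leading exponents. Unique sums in `ℕⁿ` supply a top-degree pair
  -- whose sum no other top-degree pair attains, so `x^(α+β)` receives a single contribution.
  obtain ⟨α, hα, β, hβ, huniq⟩ := UniqueSums.uniqueAdd_of_nonempty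
    (A := (h.basis.repr f).support.filter fun γ => ∑ k, γ k = ∑ k, μ k)
    (B := (h.basis.repr g).support.filter fun γ => ∑ k, γ k = ∑ k, ν k)
    ⟨μ, by simpa using hμ⟩ ⟨ν, by simpa using hν⟩
  rw [Finset.mem_filter] at hα hβ
  refine ⟨α, β, by simpa using hα.1, by simpa using hβ.1, ?_⟩
  choose s hs hmem using h.exists_mon_mul_smul_mon hσ
  have hcoeff : ∀ γ ε, ∑ k, γ k ≤ ∑ k, α k → ∑ k, ε k ≤ ∑ k, β k →
      h.basis.repr (h.basis.repr f γ • mon x γ * (h.basis.repr g ε • mon x ε)) (α + β) =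
      if γ + ε = α + β then h.basis.repr f γ * s γ ε (h.basis.repr g ε) else 0 := by
    intro γ ε hγ hε
    have h0 := h.repr_eq_zero_of_mem_degreeLT (hmem γ ε (h.basis.repr g ε)) (γ := α + β)
      (by simp only [Pi.add_apply, Finset.sum_add_distrib]; omega)
    rw [map_sub, Finsupp.sub_apply, sub_eq_zero, map_smul, Finsupp.smul_apply, repr_mon] at h0
    rw [smul_mul_assoc, map_smul, Finsupp.smul_apply, h0]
    simp
  have hzero : h.basis.repr (f * g) (α + β) = 0 := by rw [hfg]; simp
  rw [h.eq_sum f, h.eq_sum g, Finset.sum_mul_sum, map_sum, Finsupp.finsetSum_apply,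
    Finset.sum_eq_single_of_mem α hα.1, map_sum, Finsupp.finsetSum_apply,
    Finset.sum_eq_single_of_mem β hβ.1,
    hcoeff α β le_rfl le_rfl, if_pos rfl] at hzero
  · exact (hs α β _ _).1 hzero
  · intro ε hε hne
    rw [hcoeff α ε le_rfl (hβ.2 ▸ hνmax ε hε), if_neg]
    exact fun e => hne (add_left_cancel e)
  · intro γ hγ hne
    rw [map_sum, Finsupp.finsetSum_apply]
    refine Finset.sum_eq_zero fun ε hε => ?_
    have hγle := hα.2 ▸ hμmax γ hγ
    have hεle := hβ.2 ▸ hνmax ε hε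
    rw [hcoeff γ ε hγle hεle, if_neg]
    intro e
    have hsum := congrArg (fun θ : Fin n → ℕ => ∑ k, θ k) e
    simp only [Pi.add_apply, Finset.sum_add_distrib] at hsum
    exact hne (huniq (Finset.mem_filter.2 ⟨hγ, by omega⟩)
      (Finset.mem_filter.2 ⟨hε, by omega⟩) e).1

end Degree

/-! ### Annihilation over a rigid ring -/

section Rigid

theorem isReduced_of_rigid {B : Type*} [Ring B] {φ : Fin n → B → B} (hφ : Rigid φ) :
    IsReduced B :=
  isReduced_of_mul_self fun a ha => hφ a 0 (by rwa [iter_zero])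

/-- If `aσ(b) = 0`, then `ba·σ(ba) = 0`, so rigidity kills `ba`. If `ab = 0`, then `r = aσ(b)`
satisfies `rσ(r) = 0`, because its middle factor is `σ(ba) = 0`. -/
theorem annIff_sigma (h : IsSkewPBW R x) (hr : Rigid fun i => ⇑(h.sigma i)) (i : Fin n) :
    AnnIff (h.sigma i) := by
  have := isReduced_of_rigid hr
  have hi : ∀ r, r * h.sigma i r = 0 → r = 0 := fun r hr0 =>
    hr r (Pi.single i 1) (by rwa [iter_single])
  intro a b
  constructor
  · intro hab
    apply mul_eq_zero_swap
    apply hi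
    rw [map_mul, ← mul_assoc, mul_assoc b, hab, mul_zero, zero_mul]
  · intro hab
    apply hi
    rw [map_mul, mul_assoc, ← mul_assoc (h.sigma i b), ← map_mul, mul_eq_zero_swap hab]
    simp

/-- Apply `δ` to `ab = 0`. Multiplying by `b` on the left removes `σ(a)δ(b)`, so `δ(a)b` squares to
zero. Hence `σ(a)δ(b) = 0`, and `σ` can be stripped off. -/
theorem mul_delta_eq_zero (h : IsSkewPBW R x) (hr : Rigid fun i => ⇑(h.sigma i)) (i : Fin n)
    {a b : R} (hab : a * b = 0) : a * h.delta i b = 0 := by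
  have := isReduced_of_rigid hr
  have hba := mul_eq_zero_swap hab
  have e : h.sigma i a * h.delta i b + h.delta i a * b = 0 := by
    rw [← h.delta_mul, hab, map_zero]
  have e1 : b * (h.delta i a * b) = 0 := by
    have := congrArg (b * ·) e
    simpa [mul_add, ← mul_assoc, (h.annIff_sigma hr i b a).2 hba] using this
  have e2 : h.delta i a * b = 0 :=
    eq_zero_of_pow_eq_zero (n := 2) (by rw [sq, mul_assoc, e1, mul_zero])
  rw [e2, add_zero] at e
  exact mul_eq_zero_swap ((h.annIff_sigma hr i _ _).1 (mul_eq_zero_swap e))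

theorem smul_eq_zero_iff_repr (h : IsSkewPBW R x) {a : R} {f : A} :
    a • f = 0 ↔ ∀ γ, a * h.basis.repr f γ = 0 := by
  rw [← h.basis.repr.map_eq_zero_iff, map_smul, Finsupp.ext_iff]
  rfl

/-- Left multiplication by a variable acts on coefficients through `σᵢ` and `δᵢ`, which keep them
annihilated by `a`; coefficients of `f` are inserted by reducedness. -/
theorem smul_mul_eq_zero (h : IsSkewPBW R x) (hr : Rigid fun i => ⇑(h.sigma i))
    {a : R} {g : A} (hg : a • g = 0) (f : A) : a • (f * g) = 0 := by
  have := isReduced_of_rigid hr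
  have hx : ∀ (i : Fin n) (g : A), a • g = 0 → a • (x i * g) = 0 := by
    intro i g hg
    rw [h.smul_eq_zero_iff_repr] at hg
    rw [h.eq_sum g, Finset.mul_sum, Finset.smul_sum]
    refine Finset.sum_eq_zero fun γ _ => ?_
    rw [h.rel_smul, smul_add, smul_smul, smul_smul, (h.annIff_sigma hr i _ _).2 (hg γ),
      h.mul_delta_eq_zero hr i (hg γ), zero_smul, zero_smul, add_zero]
  have hmon : ∀ α, a • (mon x α * g) = 0 := by
    intro α
    induction α using exponent_induction with
    | zero => rwa [mon_zero, one_mul]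
    | single_add j α hα ih =>
      rw [mon_single_add x hα, mul_assoc]
      exact hx j _ ih
  rw [h.eq_sum f, Finset.sum_mul, Finset.smul_sum]
  refine Finset.sum_eq_zero fun α _ => ?_
  have h1 := h.smul_eq_zero_iff_repr.1 (hmon α)
  rw [smul_mul_assoc, smul_smul, h.smul_eq_zero_iff_repr]
  exact fun γ => mul_mul_eq_zero_of_mul_eq_zero (h1 γ) _

theorem mul_eq_zero_of_coeff (h : IsSkewPBW R x) (hr : Rigid fun i => ⇑(h.sigma i)) {f g : A}
    (hfg : ∀ α β, h.basis.repr f α * h.basis.repr g β = 0) : f * g = 0 := by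
  rw [h.eq_sum f, Finset.sum_mul]
  refine Finset.sum_eq_zero fun α _ => ?_
  rw [smul_mul_assoc]
  exact h.smul_mul_eq_zero hr (h.smul_eq_zero_iff_repr.2 (hfg α)) _

/-- The Armendariz property of skew PBW extensions of rigid rings. -/
theorem mul_eq_zero_iff_coeff (h : IsSkewPBW R x) (hr : Rigid fun i => ⇑(h.sigma i)) {f g : A} :
    f * g = 0 ↔ ∀ α β, h.basis.repr f α * h.basis.repr g β = 0 := by
  refine ⟨fun hfg => ?_, h.mul_eq_zero_of_coeff hr⟩
  have hred := isReduced_of_rigid hr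
  induction hN : (h.basis.repr f).support.card + (h.basis.repr g).support.card
    using Nat.strong_induction_on generalizing f g with
  | _ N ih =>
  by_cases hf : f = 0
  · simp [hf]
  by_cases hg : g = 0
  · simp [hg]
  obtain ⟨μ, ν, hμ, hν, hμν⟩ :=
    h.exists_coeff_mul_eq_zero (h.annIff_sigma hr) hf hg hfg
  set b := h.basis.repr g ν with hb
  -- Multiplying `f` by `b` kills its `μ` coefficient, so induction applies to `b • f` and `g`. It
  -- yields `b a b = 0`, hence `a b = 0`, for every coefficient `a` of `f`. The term of `g` at `ν`
  -- can then be dropped.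
  have hlt : (h.basis.repr (b • f)).support.card < (h.basis.repr f).support.card := by
    apply Finset.card_lt_card
    refine (Finset.ssubset_iff_of_subset ?_).2 ⟨μ, by simpa using hμ, ?_⟩
    · rw [map_smul]; exact Finsupp.support_smul
    · simpa using mul_eq_zero_swap hμν
  have h1 := ih _ (by omega) (f := b • f) (g := g) (by rw [smul_mul_assoc, hfg, smul_zero]) rfl
  have h2 : ∀ α, h.basis.repr f α * b = 0 := fun α => by
    have := h1 α ν
    rw [map_smul, Finsupp.smul_apply, smul_eq_mul, mul_assoc] at this
    exact eq_zero_of_pow_eq_zero (n := 2) (by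
      rw [sq, mul_assoc, this, mul_zero])
  set g' := g - b • mon x ν with hg'
  have hrepr : ∀ β, h.basis.repr g' β = if ν = β then 0 else h.basis.repr g β := by
    intro β
    rw [hg', map_sub, map_smul, Finsupp.sub_apply, Finsupp.smul_apply, repr_mon]
    split_ifs with hνβ
    · simp [hb, hνβ]
    · simp
  have hbm : f * (b • mon x ν) = 0 := by
    apply h.mul_eq_zero_of_coeff hr
    intro α β
    rw [map_smul, Finsupp.smul_apply, repr_mon]
    split_ifs <;> simp [h2 α]
  have hlt' : (h.basis.repr g').support.card < (h.basis.repr g).support.card := by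
    apply Finset.card_lt_card
    refine (Finset.ssubset_iff_of_subset ?_).2 ⟨ν, by simpa using hν, by simp [hrepr]⟩
    intro β
    simp only [Finsupp.mem_support_iff, hrepr]
    split_ifs <;> simp
  have h3 := ih _ (by omega) (f := f) (g := g') (by rw [hg', mul_sub, hfg, hbm, sub_zero]) rfl
  intro α β
  by_cases hβ : ν = β
  · exact hβ ▸ h2 α
  · have := h3 α β
    rwa [hrepr, if_neg hβ] at this

theorem isReduced (h : IsSkewPBW R x) (hr : Rigid fun i => ⇑(h.sigma i)) : IsReduced A := by
  have hred := isReduced_of_rigid hr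
  refine isReduced_of_mul_self fun f hf => h.ext_repr fun γ => ?_
  have := (h.mul_eq_zero_iff_coeff hr).1 hf γ γ
  simpa using eq_zero_of_pow_eq_zero (n := 2) (by rw [sq, this])

theorem sigmaCompatible_sigmaBar (h : IsSkewPBW R x) (hr : Rigid fun i => ⇑(h.sigma i)) :
    SigmaCompatible h.sigmaBar := by
  intro f g α
  rw [h.mul_eq_zero_iff_coeff hr, h.mul_eq_zero_iff_coeff hr]
  refine forall₂_congr fun γ ε => ?_
  have e : h.basis.repr (iter h.sigmaBar α g) ε =
      iter (fun i => ⇑(h.sigma i)) α (h.basis.repr g ε) :=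
    iter_semiconj (g := fun f => h.basis.repr f ε)
      (fun i f => h.repr_coeffMap (h.sigma i : R →+ R) f ε) α g
  rw [e]
  exact iter_induction (P := AnnIff) (fun _ _ => Iff.rfl) (fun _ _ => AnnIff.comp)
    (h.annIff_sigma hr) α _ _

theorem deltaCompatible_deltaBar (h : IsSkewPBW R x) (hr : Rigid fun i => ⇑(h.sigma i)) :
    DeltaCompatible h.deltaBar := by
  intro f g hfg α
  rw [h.mul_eq_zero_iff_coeff hr] at hfg ⊢
  intro γ ε
  have e : h.basis.repr (iter h.deltaBar α g) ε =
      iter (fun i => ⇑(h.delta i)) α (h.basis.repr g ε) :=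
    iter_semiconj (g := fun f => h.basis.repr f ε)
      (fun i f => h.repr_coeffMap (h.delta i) f ε) α g
  rw [e]
  exact iter_induction (P := fun s : R → R => ∀ a b, a * b = 0 → a * s b = 0)
    (fun _ _ => id) (fun _ _ hs ht a b hab => hs _ _ (ht _ _ hab))
    (fun i _ _ => h.mul_delta_eq_zero hr i) α _ _ (hfg γ ε)

theorem rigid_sigmaBar (h : IsSkewPBW R x) (hr : Rigid fun i => ⇑(h.sigma i)) :
    Rigid h.sigmaBar := by
  have := h.isReduced hr
  intro f α hf
  exact eq_zero_of_pow_eq_zero (n := 2)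
    (by rw [sq]; exact (h.sigmaCompatible_sigmaBar hr f f α).1 hf)

theorem IsInduced.sigma_eq {h : IsSkewPBW R x} {A' : Type*} [Ring A'] [Module A A']
    [IsScalarTower A A' A'] {x' : Fin n → A'} (h' : h.IsInduced x') :
    (fun i => ⇑(h'.isSkewPBW.sigma i)) = h.sigmaBar := by
  funext i f
  exact (h'.isSkewPBW.eq_of_rel (h'.rel i f)).1

end Rigid

end IsSkewPBW

end SkewPBW

theorem mainTheorem5 {R A A' : Type*} [Ring R] [Ring A] [Ring A']
    [Module R A] [IsScalarTower R A A] [Module A A'] [IsScalarTower A A' A']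
    {n : ℕ} (x : Fin n → A) (x' : Fin n → A') (hA : SkewPBW.IsSkewPBW R x)
    (hrigid : SkewPBW.Rigid fun i => ⇑(hA.sigma i))
    (c : Fin n → Fin n → R) (hc : ∀ i j, SkewPBW.IsCommCoeff x i j (c i j))
    (hcentral : ∀ i j, c i j ∈ Subring.center R)
    (hA' : hA.IsInduced x') :
    SkewPBW.Reversible A ∧ SkewPBW.Compatible hA.sigmaBar hA.deltaBar ∧
      (SkewPBW.WeakSymmetric A ↔ SkewPBW.WeakSymmetric A') := by
  have hredA := hA.isReduced hrigid
  -- The endomorphisms of `A'` over `A` are the coefficientwise extensions, so rigidity passes to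
  -- the second extension.
  have hrigid' : SkewPBW.Rigid fun i => ⇑(hA'.isSkewPBW.sigma i) := by
    rw [hA'.sigma_eq]
    exact hA.rigid_sigmaBar hrigid
  have hredA' := hA'.isSkewPBW.isReduced hrigid'
  exact ⟨SkewPBW.reversible_of_isReduced,
    ⟨hA.sigmaCompatible_sigmaBar hrigid, hA.deltaCompatible_deltaBar hrigid⟩,
    fun _ => SkewPBW.weakSymmetric_of_isReduced, fun _ => SkewPBW.weakSymmetric_of_isReduced⟩
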